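/- Throughout, $q$ is a complex number with $|q|<1$, and $(a;q)_n=\prod_{j=0}^{n-1}(1-aq^j)$, $(a;q)_\infty=\prod_{j\ge 0}(1-aq^j)$. An overpartition is a partition (possibly empty) in which the first occurrence of each part may be overlined; it has distinct parts if its non-overlined parts are distinct (its overlined parts always are). An overpartition pair of $n$ is a pair $(\lambda_1,\lambda_2)$ of overpartitions the sum of all of whose parts is $n$. For $n\ge 1$ consider the overpartition pairs $\pi=(\lambda_1,\lambda_2)$ of $n$ such that $\lambda_1$ and $\lambda_2$ have distinct parts; the smallest part $s$ of $\pi$ is the smallest part of $\lambda_1$ and occurs overlined in $\lambda_1$; the non-overlined parts of $\lambda_1$ and the overlined parts of $\lambda_2$ are $>s$; and the non-overlined parts of $\lambda_2$ lie in $[s,2s)$ (the component $\lambda_2$ may be empty). Let $A_0(n)$ (resp. $A_1(n)$) be the number of such pairs whose total number of parts is even (resp. odd), and let $A'(n)=A_1(n)-A_0(n)$. **Theorem.** For every complex $q$ with $|q|<1$ the following three series converge absolutely and $$\sum_{n=1}^\infty A'(n)\,q^n=\sum_{n=1}^\infty q^n(q^{n+1};q)_\infty^3\,(q^n;q)_n=\sum_{n=1}^\infty(-1)^{n+1}n\,q^{n(n+1)/2}.$$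 -/

import Mathlib

/-- The finite `q`-Pochhammer symbol `(a;q)_n = ∏_{j=0}^{n-1} (1 - a q^j)`. -/
def qPoch (a q : ℂ) (n : ℕ) : ℂ := ∏ j ∈ Finset.range n, (1 - a * q ^ j)

/-- The infinite `q`-Pochhammer symbol `(a;q)_∞ = ∏_{j≥0} (1 - a q^j)`. -/
noncomputable def qPochInf (a q : ℂ) : ℂ := ∏' j : ℕ, (1 - a * q ^ j)

/-- For `|q| < 1` the product defining `(a;q)_∞` converges. -/
theorem qPochInf_multipliable (a q : ℂ) (hq : ‖q‖ < 1) :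
    Multipliable fun j : ℕ => 1 - a * q ^ j := by
  have h : Summable fun j : ℕ => ‖-(a * q ^ j)‖ := by
    simp only [norm_neg, norm_mul, norm_pow]
    exact (summable_geometric_of_lt_one (norm_nonneg q) hq).mul_left _
  simpa [sub_eq_add_neg] using multipliable_one_add_of_summable h

/-- An overpartition: a partition (a finite multiset of positive integers) in which the first
occurrence of each part may be overlined. As only first occurrences can be overlined, the
overlining is given by the set of those part sizes whose first occurrence is overlined. -/
@[ext]
structure Overpartition where
  /-- all parts, overlined or not, with multiplicity -/
  parts : Multiset ℕ
  parts_pos : ∀ x ∈ parts, 0 < x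
  /-- the overlined parts -/
  overlined : Finset ℕ
  overlined_subset : ∀ x ∈ overlined, x ∈ parts

namespace Overpartition

/-- The non-overlined parts: one copy of each overlined part is removed from the parts. -/
def plain (l : Overpartition) : Multiset ℕ := l.parts - l.overlined.val

/-- The overpartition has distinct parts: the non-overlined parts are distinct
(the overlined ones always are). An overlined and a non-overlined part may have equal size. -/
def DistinctParts (l : Overpartition) : Prop := l.plain.Nodup

end Overpartition

/-- The overpartition pairs `(l₁, l₂)` counted by `A`: both components have distinct parts; the
smallest part `s` of the pair is the smallest part of `l₁` and occurs overlined in `l₁`; the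
non-overlined parts of `l₁` are `> s`; the overlined parts of `l₂` are `> s`; the non-overlined
parts of `l₂` lie in `[s, 2s)`. The component `l₂` may be empty. -/
def IsAPair (p : Overpartition × Overpartition) : Prop :=
  p.1.DistinctParts ∧ p.2.DistinctParts ∧
  ∃ s : ℕ,
    IsLeast {x | x ∈ p.1.parts ∨ x ∈ p.2.parts} s ∧
    IsLeast {x | x ∈ p.1.parts} s ∧
    s ∈ p.1.overlined ∧
    (∀ x ∈ p.1.plain, s < x) ∧
    (∀ x ∈ p.2.overlined, s < x) ∧
    (∀ x ∈ p.2.plain, s ≤ x ∧ x < 2 * s)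

/-- The sum of all parts of an overpartition pair. -/
def pairSize (p : Overpartition × Overpartition) : ℕ := p.1.parts.sum + p.2.parts.sum

/-- The number of parts of an overpartition pair. -/
def numParts (p : Overpartition × Overpartition) : ℕ := p.1.parts.card + p.2.parts.card

/-- There are finitely many overpartition pairs of `n`, so the cardinalities below are genuine. -/
theorem finite_pairSize (n : ℕ) : {p | pairSize p = n}.Finite := by
  have hm : ∀ l : Overpartition, l.parts.sum ≤ n →
      l.parts ∈ (n • Multiset.range (n + 1)).powerset.toFinset := by
    intro l hl
    rw [Multiset.mem_toFinset, Multiset.mem_powerset, Multiset.le_iff_count]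
    intro a
    by_cases ha : a ∈ l.parts
    · have h1 : a ≤ n := (Multiset.single_le_sum (fun _ _ => Nat.zero_le _) a ha).trans hl
      have h2 : l.parts.card ≤ l.parts.sum := by
        simpa using Multiset.card_nsmul_le_sum (s := l.parts) (a := 1) l.parts_pos
      have h3 : Multiset.count a (Multiset.range (n + 1)) = 1 :=
        Multiset.count_eq_one_of_mem (Multiset.nodup_range _) (Multiset.mem_range.2 (Nat.lt_succ_of_le h1))
      rw [Multiset.count_nsmul, h3, mul_one]
      exact (Multiset.count_le_card _ _).trans (h2.trans hl)
    · simp [Multiset.count_eq_zero_of_notMem ha]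
  have ho : ∀ l : Overpartition, l.parts.sum ≤ n →
      l.overlined ∈ (Finset.range (n + 1)).powerset := by
    intro l hl
    rw [Finset.mem_powerset]
    intro a ha
    have h1 := (Multiset.single_le_sum (fun _ _ => Nat.zero_le _) a
      (l.overlined_subset a ha)).trans hl
    exact Finset.mem_range.2 (Nat.lt_succ_of_le h1)
  have hf : {l : Overpartition | l.parts.sum ≤ n}.Finite := by
    refine Set.Finite.of_finite_image (f := fun l => (l.parts, l.overlined)) ?_ ?_
    · refine Set.Finite.subset (((n • Multiset.range (n + 1)).powerset.toFinset ×ˢ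
        (Finset.range (n + 1)).powerset).finite_toSet) ?_
      rintro _ ⟨l, hl, rfl⟩
      exact Finset.mem_coe.2 (Finset.mem_product.2 ⟨hm l hl, ho l hl⟩)
    · intro l _ m _ h
      simp only [Prod.mk.injEq] at h
      exact Overpartition.ext h.1 h.2
  refine (hf.prod hf).subset ?_
  intro p hp
  simp only [pairSize, Set.mem_ofPred_eq] at hp
  exact ⟨by simp only [Set.mem_ofPred_eq]; omega, by simp only [Set.mem_ofPred_eq]; omega⟩

/-- `A₀(n)`: the pairs counted by `A(n)` with an even number of parts. -/
noncomputable def A0 (n : ℕ) : ℕ :=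
  {p | IsAPair p ∧ pairSize p = n ∧ Even (numParts p)}.ncard

/-- `A₁(n)`: the pairs counted by `A(n)` with an odd number of parts. -/
noncomputable def A1 (n : ℕ) : ℕ :=
  {p | IsAPair p ∧ pairSize p = n ∧ Odd (numParts p)}.ncard

/-- `A'(n) = A₁(n) - A₀(n)`. -/
noncomputable def A' (n : ℕ) : ℤ := (A1 n : ℤ) - (A0 n : ℤ)

/-!
Write `(a)_n` and `(a)_∞` for the `q`-Pochhammer symbols with base `q`.

*Combinatorial half.* An overpartition with distinct parts is the same as two finite sets, of its
overlined and of its non-overlined parts. So a pair counted by `A` with smallest part `s` is given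
by `s`, three finite sets of integers `> s` and one finite set of integers in `[s, 2s)`
(`PairCode.toPair_injective`, `PairCode.range_toPair`). Expanding the products `(q^{s+1})_∞³ (q^s)_s`
over finite sets shows that the `s`-th term of the middle series is the signed sum over these pairs
(`PairCode.hasSum_weight_fiber`). Everything converges absolutely (`PairCode.summable_weight`), so
the sum over all pairs may also be grouped by size, which gives the series of the `A' n`
(`hasSum_A'`).

*Analytic half.* Put
`W(c) = ∑_{n ≥ 0} q^n (q^{n+1})_∞ (cq^{n+1})_∞² (c²q^n)_n` and
`H(c) = ∑_{m ≥ 0} (-1)^m (m+1) q^{m(m+1)/2} c^m`.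
After the shift `n ↦ n + 1` the middle and the last series are `q W(q)` and `q H(q)`, term by term.
Both functions satisfy
`X(c) + 2cq X(cq) + c²q³ X(cq²) = 1`:
for `H` this compares coefficients (`partialTheta_recurrence`), for `W` the summand telescopes
with an explicit certificate (`cert_succ_sub`, `hyper_recurrence`). Since `W` and `H` are bounded on
the unit disc, the difference `D k = W(q^{k+1}) - H(q^{k+1})` is a bounded solution of a homogeneous
recurrence with geometrically small coefficients, hence zero (`eq_zero_of_recurrence`).
-/

/-! ### Size estimates for `q`-Pochhammer symbols -/

section Pochhammer

variable {q : ℂ}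

theorem norm_qPoch_sub_one_le (hq : ‖q‖ < 1) (a : ℂ) (n : ℕ) :
    ‖qPoch a q n - 1‖ ≤ Real.exp (‖a‖ / (1 - ‖q‖)) - 1 := by
  have h := (Finset.range n).norm_prod_one_add_sub_one_le fun j => -(a * q ^ j)
  simp only [← sub_eq_add_neg] at h
  refine h.trans ?_
  gcongr
  simp only [norm_neg, norm_mul, norm_pow, ← Finset.mul_sum, div_eq_mul_inv]
  gcongr
  rw [← tsum_geometric_of_lt_one (norm_nonneg q) hq]
  exact (summable_geometric_of_lt_one (norm_nonneg q) hq).sum_le_tsum _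
    fun _ _ => by positivity

theorem tendsto_qPoch (hq : ‖q‖ < 1) (a : ℂ) :
    Filter.Tendsto (qPoch a q) Filter.atTop (nhds (qPochInf a q)) :=
  (qPochInf_multipliable a q hq).tendsto_prod_tprod_nat

theorem norm_qPochInf_sub_one_le (hq : ‖q‖ < 1) (a : ℂ) :
    ‖qPochInf a q - 1‖ ≤ Real.exp (‖a‖ / (1 - ‖q‖)) - 1 :=
  le_of_tendsto ((tendsto_qPoch hq a).sub_const 1).norm
    (Filter.Eventually.of_forall fun n => norm_qPoch_sub_one_le hq a n)

theorem norm_le_of_norm_sub_one_le {z : ℂ} {r : ℝ} (h : ‖z - 1‖ ≤ r - 1) : ‖z‖ ≤ r := by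
  have := norm_add_le (z - 1) 1
  simp only [sub_add_cancel, norm_one] at this
  linarith

theorem norm_qPoch_le (hq : ‖q‖ < 1) {a : ℂ} (ha : ‖a‖ ≤ 1) (n : ℕ) :
    ‖qPoch a q n‖ ≤ Real.exp (1 / (1 - ‖q‖)) := by
  refine (norm_le_of_norm_sub_one_le (norm_qPoch_sub_one_le hq a n)).trans ?_
  have : 0 < 1 - ‖q‖ := by linarith
  gcongr

theorem norm_qPochInf_le (hq : ‖q‖ < 1) {a : ℂ} (ha : ‖a‖ ≤ 1) :
    ‖qPochInf a q‖ ≤ Real.exp (1 / (1 - ‖q‖)) :=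
  le_of_tendsto (tendsto_qPoch hq a).norm
    (Filter.Eventually.of_forall fun n => norm_qPoch_le hq ha n)

theorem tendsto_exp_div_sub_one {a : ℕ → ℂ} (ha : Filter.Tendsto a Filter.atTop (nhds 0))
    (r : ℝ) :
    Filter.Tendsto (fun n => Real.exp (‖a n‖ / r) - 1) Filter.atTop (nhds 0) := by
  have h : Filter.Tendsto (fun n => ‖a n‖ / r) Filter.atTop (nhds 0) := by
    simpa using ha.norm.div_const r
  simpa using ((Real.continuous_exp.tendsto 0).comp h).sub_const 1

/-- `(a_n)_n → 1` when `a_n → 0`, although the length of the product grows as well. -/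
theorem tendsto_qPoch_one (hq : ‖q‖ < 1) {a : ℕ → ℂ}
    (ha : Filter.Tendsto a Filter.atTop (nhds 0)) :
    Filter.Tendsto (fun n => qPoch (a n) q n) Filter.atTop (nhds 1) := by
  rw [tendsto_iff_norm_sub_tendsto_zero]
  exact squeeze_zero (fun _ => norm_nonneg _) (fun n => norm_qPoch_sub_one_le hq (a n) n)
    (tendsto_exp_div_sub_one ha _)

theorem tendsto_qPochInf_one (hq : ‖q‖ < 1) {a : ℕ → ℂ}
    (ha : Filter.Tendsto a Filter.atTop (nhds 0)) :
    Filter.Tendsto (fun n => qPochInf (a n) q) Filter.atTop (nhds 1) := by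
  rw [tendsto_iff_norm_sub_tendsto_zero]
  exact squeeze_zero (fun _ => norm_nonneg _) (fun n => norm_qPochInf_sub_one_le hq (a n))
    (tendsto_exp_div_sub_one ha _)

theorem qPoch_add (a q : ℂ) (m n : ℕ) :
    qPoch a q (m + n) = qPoch a q m * qPoch (a * q ^ m) q n := by
  simp only [qPoch, Finset.prod_range_add]
  congr 1
  exact Finset.prod_congr rfl fun j _ => by ring

theorem qPoch_one (a q : ℂ) : qPoch a q 1 = 1 - a := by simp [qPoch]

theorem qPoch_two (a q : ℂ) : qPoch a q 2 = (1 - a) * (1 - a * q) := by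
  simp [qPoch, Finset.prod_range_succ]

/-- `(a)_∞ = (1 - a) (aq)_∞`. -/
theorem qPochInf_eq (hq : ‖q‖ < 1) (a : ℂ) :
    qPochInf a q = (1 - a) * qPochInf (a * q) q := by
  have hs : Multipliable fun j : ℕ => 1 - a * q ^ (j + 1) :=
    (qPochInf_multipliable (a * q) q hq).congr fun j => by ring
  have h := tprod_eq_zero_mul' (f := fun j : ℕ => 1 - a * q ^ j) hs
  have e : ∀ j : ℕ, 1 - a * q ^ (j + 1) = 1 - a * q * q ^ j := fun j => by ring
  simp only [pow_zero, mul_one, e] at h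
  exact h

end Pochhammer

/-! ### The partial theta series and its second-order `q`-difference equation -/

section PartialTheta

variable {q : ℂ}

/-- The summand `(-1)^m (m+1) q^{m(m+1)/2} c^m` of a weighted partial theta series; `H(c)` denotes
its sum over `m ≥ 0`. -/
def partialThetaTerm (q c : ℂ) (m : ℕ) : ℂ :=
  (-1) ^ m * (m + 1) * q ^ (m * (m + 1) / 2) * c ^ m

theorem norm_partialThetaTerm_le (hq : ‖q‖ < 1) {c : ℂ} (hc : ‖c‖ ≤ 1) (m : ℕ) :
    ‖partialThetaTerm q c m‖ ≤ (m + 1) * ‖q‖ ^ m := by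
  have h1 : m ≤ m * (m + 1) / 2 := by
    rw [Nat.le_div_iff_mul_le two_pos]
    rcases m with _ | m
    · simp
    · gcongr; omega
  have h2 : ‖((m : ℂ) + 1)‖ = (m : ℝ) + 1 := by exact_mod_cast Complex.norm_natCast (m + 1)
  simp only [partialThetaTerm, norm_mul, norm_pow, norm_neg, norm_one, one_pow, one_mul, h2]
  calc ((m : ℝ) + 1) * ‖q‖ ^ (m * (m + 1) / 2) * ‖c‖ ^ m
      ≤ ((m : ℝ) + 1) * ‖q‖ ^ m * 1 := by
        gcongr ?_ * ?_ * ?_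
        · exact pow_le_pow_of_le_one (norm_nonneg q) hq.le h1
        · exact pow_le_one₀ (norm_nonneg c) hc
    _ = _ := mul_one _

theorem summable_succ_mul_norm_pow (hq : ‖q‖ < 1) :
    Summable fun m : ℕ => ((m : ℝ) + 1) * ‖q‖ ^ m := by
  have h1 := summable_pow_mul_geometric_of_norm_lt_one 1 (r := ‖q‖) (by simpa using hq)
  have h0 := summable_geometric_of_lt_one (norm_nonneg q) hq
  exact (h1.add h0).congr fun m => by ring

theorem summable_partialThetaTerm (hq : ‖q‖ < 1) {c : ℂ} (hc : ‖c‖ ≤ 1) :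
    Summable (partialThetaTerm q c) :=
  .of_norm_bounded (summable_succ_mul_norm_pow hq) (norm_partialThetaTerm_le hq hc)

theorem norm_tsum_partialThetaTerm_le (hq : ‖q‖ < 1) {c : ℂ} (hc : ‖c‖ ≤ 1) :
    ‖∑' m, partialThetaTerm q c m‖ ≤ ∑' m : ℕ, ((m : ℝ) + 1) * ‖q‖ ^ m :=
  tsum_of_norm_bounded (summable_succ_mul_norm_pow hq).hasSum (norm_partialThetaTerm_le hq hc)

theorem norm_mul_pow_le_one (hq : ‖q‖ < 1) {c : ℂ} (hc : ‖c‖ ≤ 1) (k : ℕ) :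
    ‖c * q ^ k‖ ≤ 1 := by
  rw [norm_mul, norm_pow]
  exact mul_le_one₀ hc (by positivity) (pow_le_one₀ (norm_nonneg q) hq.le)

/-- `H(c) + 2cq H(cq) + c²q³ H(cq²) = 1`: the coefficients `m + 1` are annihilated by the second
difference. -/
theorem partialTheta_recurrence (hq : ‖q‖ < 1) {c : ℂ} (hc : ‖c‖ ≤ 1) :
    ∑' m, partialThetaTerm q c m + 2 * c * q * ∑' m, partialThetaTerm q (c * q) m
      + c ^ 2 * q ^ 3 * ∑' m, partialThetaTerm q (c * q ^ 2) m = 1 := by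
  have s0 := summable_partialThetaTerm hq hc
  have s1 := (summable_partialThetaTerm hq
    (by simpa using norm_mul_pow_le_one hq hc 1 : ‖c * q‖ ≤ 1)).mul_left (2 * c * q)
  have s2 := (summable_partialThetaTerm hq (norm_mul_pow_le_one hq hc 2)).mul_left (c ^ 2 * q ^ 3)
  rw [← tsum_mul_left, ← tsum_mul_left, s0.tsum_eq_zero_add,
    ((summable_nat_add_iff 1).2 s0).tsum_eq_zero_add, s1.tsum_eq_zero_add]
  have key : ∀ m : ℕ, partialThetaTerm q c (m + 1 + 1)
      + 2 * c * q * partialThetaTerm q (c * q) (m + 1)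
      + c ^ 2 * q ^ 3 * partialThetaTerm q (c * q ^ 2) m = 0 := by
    intro m
    have e1 : (m + 1 + 1) * (m + 1 + 1 + 1) / 2 = m * (m + 1) / 2 + 2 * m + 3 := by
      have : (m + 1 + 1) * (m + 1 + 1 + 1) = m * (m + 1) + 2 * (2 * m + 3) := by ring
      omega
    have e2 : (m + 1) * (m + 1 + 1) / 2 = m * (m + 1) / 2 + m + 1 := by
      have : (m + 1) * (m + 1 + 1) = m * (m + 1) + 2 * (m + 1) := by ring
      omega
    simp only [partialThetaTerm, e1, e2]
    push_cast
    ring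
  have s0' := (summable_nat_add_iff 1).2 ((summable_nat_add_iff 1).2 s0)
  have s1' := (summable_nat_add_iff 1).2 s1
  have tail := (s0'.add s1').tsum_add s2
  rw [s0'.tsum_add s1', tsum_congr key, tsum_zero] at tail
  have h0 : partialThetaTerm q c 0 = 1 := by simp [partialThetaTerm]
  have h1 : partialThetaTerm q c (0 + 1) + 2 * c * q * partialThetaTerm q (c * q) 0 = 0 := by
    simp [partialThetaTerm]; ring
  linear_combination h0 + h1 - tail

end PartialTheta

/-! ### The `q`-hypergeometric series with the same `q`-difference equation -/

section Hypergeometric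

variable {q : ℂ}

/-- The summand `q^n (q^{n+1})_∞ (cq^{n+1})_∞² (c²q^n)_n`; `W(c)` denotes its sum over `n ≥ 0`. -/
noncomputable def hyperTerm (q c : ℂ) (n : ℕ) : ℂ :=
  q ^ n * qPochInf (q ^ (n + 1)) q * qPochInf (c * q ^ (n + 1)) q ^ 2 * qPoch (c ^ 2 * q ^ n) q n

theorem norm_hyperTerm_le (hq : ‖q‖ < 1) {c : ℂ} (hc : ‖c‖ ≤ 1) (n : ℕ) :
    ‖hyperTerm q c n‖ ≤ ‖q‖ ^ n * Real.exp (1 / (1 - ‖q‖)) ^ 4 := by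
  have h1 := norm_qPochInf_le hq (by simpa using norm_mul_pow_le_one hq (c := 1) (by simp) (n + 1) :
    ‖q ^ (n + 1)‖ ≤ 1)
  have h2 := norm_qPochInf_le hq (norm_mul_pow_le_one hq hc (n + 1))
  have h3 := norm_qPoch_le hq (norm_mul_pow_le_one hq (c := c ^ 2)
    (by rw [norm_pow]; exact pow_le_one₀ (norm_nonneg c) hc) n) n
  rw [hyperTerm, norm_mul, norm_mul, norm_mul, norm_pow, norm_pow (qPochInf (c * _) q)]
  calc _ ≤ ‖q‖ ^ n * Real.exp (1 / (1 - ‖q‖)) * Real.exp (1 / (1 - ‖q‖)) ^ 2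
        * Real.exp (1 / (1 - ‖q‖)) := by gcongr
    _ = _ := by ring

theorem summable_norm_pow_mul (hq : ‖q‖ < 1) (M : ℝ) : Summable fun n : ℕ => ‖q‖ ^ n * M :=
  (summable_geometric_of_lt_one (norm_nonneg q) hq).mul_right M

theorem summable_hyperTerm (hq : ‖q‖ < 1) {c : ℂ} (hc : ‖c‖ ≤ 1) : Summable (hyperTerm q c) :=
  .of_norm_bounded (summable_norm_pow_mul hq _) (norm_hyperTerm_le hq hc)

theorem norm_tsum_hyperTerm_le (hq : ‖q‖ < 1) {c : ℂ} (hc : ‖c‖ ≤ 1) :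
    ‖∑' n, hyperTerm q c n‖ ≤ ∑' n : ℕ, ‖q‖ ^ n * Real.exp (1 / (1 - ‖q‖)) ^ 4 :=
  tsum_of_norm_bounded (summable_norm_pow_mul hq _).hasSum (norm_hyperTerm_le hq hc)

/-- The polynomial part, in `x = q^n`, of the telescoping certificate. -/
def certPoly (q c x : ℂ) : ℂ :=
  1 - 2 * c * q * x + (c ^ 2 * q ^ 2 + 2 * c ^ 3 * q ^ 3) * x ^ 2
    - c ^ 4 * (q + q ^ 2 + q ^ 3 + q ^ 4) * x ^ 3 + (2 * c ^ 5 * q ^ 2 + c ^ 6 * q ^ 3) * x ^ 4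
    - 2 * c ^ 7 * q ^ 4 * x ^ 5 + c ^ 8 * q ^ 5 * x ^ 6

/-- An antidifference of `hyperTerm q c n + 2cq hyperTerm q (cq) n + c²q³ hyperTerm q (cq²) n`,
of the form produced by Zeilberger's algorithm. -/
noncomputable def cert (q c : ℂ) (n : ℕ) : ℂ :=
  qPochInf (q ^ n) q * qPochInf (c * q ^ (n + 2)) q ^ 2 * qPoch (c ^ 2 * q ^ n) q n *
    (certPoly q c (q ^ n) /
      ((1 - c ^ 2 * q ^ n) * (1 - c ^ 2 * q ^ (n + 1)) * (1 - c ^ 2 * q ^ (n + 2))))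

theorem one_sub_sq_mul_pow_ne_zero (hq : ‖q‖ < 1) {c : ℂ} (hc : ‖c‖ < 1) (k : ℕ) :
    1 - c ^ 2 * q ^ k ≠ 0 := by
  intro h
  have h1 : ‖c ^ 2 * q ^ k‖ = 1 := by rw [← sub_eq_zero.1 h, norm_one]
  rw [norm_mul, norm_pow, norm_pow] at h1
  have h2 : ‖q‖ ^ k ≤ 1 := pow_le_one₀ (norm_nonneg q) hq.le
  nlinarith [norm_nonneg c, pow_nonneg (norm_nonneg q) k]

/-- The telescoping relation. Everything is expressed through `x = q^n`, `(q^{n+1})_∞`,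
`(cq^{n+3})_∞` and `(c²q^n)_n`, which leaves an identity between rational functions. The hypothesis
`‖c‖ < 1` keeps the denominators away from zero. -/
theorem cert_succ_sub (hq : ‖q‖ < 1) {c : ℂ} (hc : ‖c‖ < 1) (n : ℕ) :
    hyperTerm q c n + 2 * c * q * hyperTerm q (c * q) n + c ^ 2 * q ^ 3 * hyperTerm q (c * q ^ 2) n
      = cert q c (n + 1) - cert q c n := by
  have z0 := one_sub_sq_mul_pow_ne_zero hq hc n
  have z1 := one_sub_sq_mul_pow_ne_zero hq hc (n + 1)
  have z2 := one_sub_sq_mul_pow_ne_zero hq hc (n + 2)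
  have z3 := one_sub_sq_mul_pow_ne_zero hq hc (n + 3)
  have p1 : qPochInf (q ^ n) q = (1 - q ^ n) * qPochInf (q ^ (n + 1)) q := by
    rw [qPochInf_eq hq, pow_succ]
  have f1 : qPochInf (c * q ^ (n + 1)) q
      = (1 - c * q ^ (n + 1)) * ((1 - c * q ^ (n + 2)) * qPochInf (c * q ^ (n + 3)) q) := by
    rw [qPochInf_eq hq, qPochInf_eq hq (c * q ^ (n + 1) * q)]; ring_nf
  have f2 : qPochInf (c * q ^ (n + 2)) q = (1 - c * q ^ (n + 2)) * qPochInf (c * q ^ (n + 3)) q := by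
    rw [qPochInf_eq hq]; ring_nf
  have hN1 : qPoch (c ^ 2 * q ^ (n + 1)) q (n + 1) = qPoch (c ^ 2 * q ^ n) q n
      * ((1 - c ^ 2 * q ^ (2 * n)) * (1 - c ^ 2 * q ^ (2 * n + 1))) / (1 - c ^ 2 * q ^ n) := by
    rw [eq_div_iff z0]
    have a := qPoch_add (c ^ 2 * q ^ n) q 1 (n + 1)
    have b := qPoch_add (c ^ 2 * q ^ n) q n 2
    rw [qPoch_one, mul_assoc, ← pow_add] at a
    rw [qPoch_two] at b
    rw [mul_comm, ← a, show 1 + (n + 1) = n + 2 by ring, b]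
    ring
  have hN2 : qPoch ((c * q) ^ 2 * q ^ n) q n = qPoch (c ^ 2 * q ^ n) q n
      * ((1 - c ^ 2 * q ^ (2 * n)) * (1 - c ^ 2 * q ^ (2 * n + 1)))
      / ((1 - c ^ 2 * q ^ n) * (1 - c ^ 2 * q ^ (n + 1))) := by
    rw [eq_div_iff (mul_ne_zero z0 z1)]
    have a := qPoch_add (c ^ 2 * q ^ n) q 2 n
    have b := qPoch_add (c ^ 2 * q ^ n) q n 2
    rw [add_comm, b, qPoch_two, qPoch_two] at a
    rw [show (c * q) ^ 2 * q ^ n = c ^ 2 * q ^ n * q ^ 2 by ring]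
    linear_combination -a
  have hN4 : qPoch ((c * q ^ 2) ^ 2 * q ^ n) q n = qPoch (c ^ 2 * q ^ n) q n
      * ((1 - c ^ 2 * q ^ (2 * n)) * (1 - c ^ 2 * q ^ (2 * n + 1))
        * (1 - c ^ 2 * q ^ (2 * n + 2)) * (1 - c ^ 2 * q ^ (2 * n + 3)))
      / ((1 - c ^ 2 * q ^ n) * (1 - c ^ 2 * q ^ (n + 1)) * (1 - c ^ 2 * q ^ (n + 2))
        * (1 - c ^ 2 * q ^ (n + 3))) := by
    rw [eq_div_iff (mul_ne_zero (mul_ne_zero (mul_ne_zero z0 z1) z2) z3)]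
    have a := qPoch_add (c ^ 2 * q ^ n) q 4 n
    have b := qPoch_add (c ^ 2 * q ^ n) q n 4
    rw [add_comm, b, show 4 = 2 + 2 from rfl, qPoch_add _ q 2 2, qPoch_add _ q 2 2] at a
    simp only [qPoch_two] at a
    rw [show (c * q ^ 2) ^ 2 * q ^ n = c ^ 2 * q ^ n * q ^ (2 + 2) by ring]
    linear_combination -a
  have g1 : c * q * q ^ (n + 1) = c * q ^ (n + 2) := by ring
  have g2 : c * q ^ 2 * q ^ (n + 1) = c * q ^ (n + 3) := by ring
  simp only [cert, hyperTerm]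
  rw [hN1, hN2, hN4, g1, g2, p1, show n + 1 + 2 = n + 3 by ring,
    show n + 1 + 1 = n + 2 by ring, f1, f2, certPoly, certPoly]
  generalize qPochInf (q ^ (n + 1)) q = u
  generalize qPochInf (c * q ^ (n + 3)) q = F
  generalize qPoch (c ^ 2 * q ^ n) q n = N
  clear hN1 hN2 hN4 p1 f1 f2 g1 g2
  generalize hd0 : 1 - c ^ 2 * q ^ n = d0 at *
  generalize hd1 : 1 - c ^ 2 * q ^ (n + 1) = d1 at *
  generalize hd2 : 1 - c ^ 2 * q ^ (n + 2) = d2 at *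
  generalize hd3 : 1 - c ^ 2 * q ^ (n + 3) = d3 at *
  simp only [pow_add, pow_mul, mul_comm 2 n, pow_one] at *
  generalize q ^ n = x at *
  field_simp
  simp only [← hd0, ← hd1, ← hd2, ← hd3]
  ring

theorem tendsto_const_mul_pow_add (hq : ‖q‖ < 1) (a : ℂ) (k : ℕ) :
    Filter.Tendsto (fun n : ℕ => a * q ^ (n + k)) Filter.atTop (nhds 0) := by
  simpa using ((tendsto_pow_atTop_nhds_zero_of_norm_lt_one hq).comp
    (Filter.tendsto_add_atTop_nat k)).const_mul a

theorem tendsto_cert (hq : ‖q‖ < 1) (c : ℂ) :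
    Filter.Tendsto (cert q c) Filter.atTop (nhds 1) := by
  have h1 := tendsto_qPochInf_one hq (by simpa using tendsto_const_mul_pow_add hq 1 0)
  have h2 := tendsto_qPochInf_one hq (tendsto_const_mul_pow_add hq c 2)
  have h3 := tendsto_qPoch_one hq (by simpa using tendsto_const_mul_pow_add hq (c ^ 2) 0)
  have h4 : ContinuousAt (fun x => certPoly q c x /
      ((1 - c ^ 2 * x) * (1 - c ^ 2 * (x * q)) * (1 - c ^ 2 * (x * q ^ 2)))) 0 := by
    unfold certPoly
    exact ContinuousAt.div (by fun_prop) (by fun_prop) (by simp)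
  have h5 := h4.tendsto.comp (tendsto_pow_atTop_nhds_zero_of_norm_lt_one hq)
  have h := ((h1.mul (h2.pow 2)).mul h3).mul h5
  simp only [certPoly, mul_zero, zero_mul, ne_eq, OfNat.ofNat_ne_zero, not_false_eq_true, zero_pow,
    sub_zero, add_zero, mul_one, one_pow, div_one] at h
  refine h.congr fun n => ?_
  simp only [cert, certPoly, Function.comp, pow_add, pow_one]

theorem cert_zero (hq : ‖q‖ < 1) (c : ℂ) : cert q c 0 = 0 := by
  simp [cert, qPochInf_eq hq 1]

/-- `W(c) + 2cq W(cq) + c²q³ W(cq²) = 1`, by telescoping. -/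
theorem hyper_recurrence (hq : ‖q‖ < 1) {c : ℂ} (hc : ‖c‖ < 1) :
    ∑' n, hyperTerm q c n + 2 * c * q * ∑' n, hyperTerm q (c * q) n
      + c ^ 2 * q ^ 3 * ∑' n, hyperTerm q (c * q ^ 2) n = 1 := by
  have s0 := summable_hyperTerm hq hc.le
  have s1 := (summable_hyperTerm hq
    (by simpa using norm_mul_pow_le_one hq hc.le 1 : ‖c * q‖ ≤ 1)).mul_left (2 * c * q)
  have s2 := (summable_hyperTerm hq (norm_mul_pow_le_one hq hc.le 2)).mul_left (c ^ 2 * q ^ 3)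
  rw [← tsum_mul_left, ← tsum_mul_left, ← s0.tsum_add s1, ← (s0.add s1).tsum_add s2]
  refine tendsto_nhds_unique ((s0.add s1).add s2).tendsto_sum_tsum_nat ?_
  simp only [cert_succ_sub hq hc, Finset.sum_range_sub, cert_zero hq, sub_zero]
  exact tendsto_cert hq c

/-- A bounded solution of a homogeneous recurrence whose coefficients decay geometrically
vanishes. -/
theorem eq_zero_of_recurrence (hq : ‖q‖ < 1) {D : ℕ → ℂ} {M : ℝ} (hM : ∀ k, ‖D k‖ ≤ M)
    (hD : ∀ k, D k + 2 * q ^ (k + 1) * q * D (k + 1)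
      + (q ^ (k + 1)) ^ 2 * q ^ 3 * D (k + 2) = 0) (k : ℕ) : D k = 0 := by
  -- Each value is at most `3‖q‖^k` times a bound for the next two.
  have hbound : ∀ (k : ℕ) (B : ℝ), ‖D (k + 1)‖ ≤ B → ‖D (k + 2)‖ ≤ B →
      ‖D k‖ ≤ 3 * ‖q‖ ^ k * B := by
    intro k B h1 h2
    have hB : 0 ≤ B := (norm_nonneg _).trans h1
    have e : D k = -(2 * q ^ (k + 2) * D (k + 1)) - q ^ (2 * k + 5) * D (k + 2) := by
      linear_combination hD k
    have a1 : ‖q‖ ^ (k + 2) ≤ ‖q‖ ^ k := pow_le_pow_of_le_one (norm_nonneg q) hq.le (by omega)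
    have a2 : ‖q‖ ^ (2 * k + 5) ≤ ‖q‖ ^ k := pow_le_pow_of_le_one (norm_nonneg q) hq.le (by omega)
    calc ‖D k‖ ≤ ‖2 * q ^ (k + 2) * D (k + 1)‖ + ‖q ^ (2 * k + 5) * D (k + 2)‖ := by
          rw [e]; exact (norm_sub_le _ _).trans (by rw [norm_neg])
      _ = 2 * ‖q‖ ^ (k + 2) * ‖D (k + 1)‖ + ‖q‖ ^ (2 * k + 5) * ‖D (k + 2)‖ := by simp
      _ ≤ 2 * ‖q‖ ^ k * B + ‖q‖ ^ k * B := by gcongr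
      _ = _ := by ring
  obtain ⟨K, hK⟩ : ∃ K, ∀ k ≥ K, 3 * ‖q‖ ^ k ≤ 1 / 2 := by
    have h := (tendsto_pow_atTop_nhds_zero_of_lt_one (norm_nonneg q) hq).const_mul 3
    rw [mul_zero] at h
    exact Filter.eventually_atTop.1 (h.eventually_le_const (by norm_num))
  -- From `K` on, any bound for all values can be halved.
  have hhalf : ∀ j : ℕ, ∀ k ≥ K, ‖D k‖ ≤ (1 / 2) ^ j * M := by
    intro j
    induction j with
    | zero => intro k _; simpa using hM k
    | succ j ih =>
      intro k hk
      have h1 := ih (k + 1) (by omega)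
      refine (hbound k _ h1 (ih (k + 2) (by omega))).trans ?_
      rw [pow_succ', mul_assoc (1 / 2 : ℝ)]
      exact mul_le_mul_of_nonneg_right (hK k hk) ((norm_nonneg _).trans h1)
  have hlarge : ∀ k ≥ K, D k = 0 := by
    intro k hk
    have h : Filter.Tendsto (fun j : ℕ => (1 / 2 : ℝ) ^ j * M) Filter.atTop (nhds 0) := by
      simpa using (tendsto_pow_atTop_nhds_zero_of_lt_one (r := (1 / 2 : ℝ))
        (by norm_num) (by norm_num)).mul_const M
    exact norm_le_zero_iff.1 (ge_of_tendsto' h fun j => hhalf j k hk)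
  -- Vanishing propagates down from the indices `≥ K`.
  have hdown : ∀ j k : ℕ, K ≤ k + j → D k = 0 := by
    intro j
    induction j with
    | zero => intro k hk; exact hlarge k hk
    | succ j ih =>
      intro k hk
      have h := hbound k 0 (by rw [ih (k + 1) (by omega), norm_zero])
        (by rw [ih (k + 2) (by omega), norm_zero])
      exact norm_le_zero_iff.1 (by simpa using h)
  exact hdown K k (by omega)

/-- `W(q) = H(q)`: the differences `W(q^{k+1}) - H(q^{k+1})` are a bounded solution of the
homogeneous recurrence. -/
theorem tsum_hyperTerm_self (hq : ‖q‖ < 1) :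
    ∑' n, hyperTerm q q n = ∑' m, partialThetaTerm q q m := by
  have hc : ∀ k : ℕ, ‖q ^ (k + 1)‖ < 1 := fun k => by
    rw [norm_pow]; exact pow_lt_one₀ (norm_nonneg q) hq (by omega)
  have h := eq_zero_of_recurrence hq
    (D := fun k => ∑' n, hyperTerm q (q ^ (k + 1)) n - ∑' m, partialThetaTerm q (q ^ (k + 1)) m)
    (fun k => (norm_sub_le _ _).trans (add_le_add (norm_tsum_hyperTerm_le hq (hc k).le)
      (norm_tsum_partialThetaTerm_le hq (hc k).le)))
    (fun k => by
      have h1 := hyper_recurrence hq (hc k)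
      have h2 := partialTheta_recurrence hq (hc k).le
      rw [← pow_succ, ← pow_add] at h1 h2
      linear_combination h1 - h2) 0
  simpa [sub_eq_zero] using h

end Hypergeometric

/-! ### Signed generating functions of finite sets of parts -/

section PartSets

/-- The weight `∏_{i ∈ E} (-q^i)` of a finite set `E` of parts, or `0` if some part violates the
constraint `p`. -/
def partWeight (q : ℂ) (p : ℕ → Prop) [DecidablePred p] (E : Finset ℕ) : ℂ :=
  ∏ i ∈ E, if p i then -q ^ i else 0

variable {q : ℂ} {p : ℕ → Prop} [DecidablePred p] {E : Finset ℕ}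

theorem partWeight_of_forall (h : ∀ i ∈ E, p i) :
    partWeight q p E = (-1) ^ E.card * q ^ E.sum id := by
  rw [partWeight, Finset.prod_congr rfl fun i hi => if_pos (h i hi), Finset.prod_neg,
    Finset.prod_pow_eq_pow_sum]
  rfl

theorem forall_of_partWeight_ne_zero (h : partWeight q p E ≠ 0) : ∀ i ∈ E, p i := by
  intro i hi
  by_contra hp
  exact h (Finset.prod_eq_zero hi (if_neg hp))

theorem norm_partWeight_le (q : ℂ) (p : ℕ → Prop) [DecidablePred p] (E : Finset ℕ) :
    ‖partWeight q p E‖ ≤ ∏ i ∈ E, ‖q‖ ^ i := by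
  rw [partWeight, norm_prod]
  refine Finset.prod_le_prod (fun _ _ => norm_nonneg _) fun i _ => ?_
  split_ifs <;> simp

theorem summable_prod_norm_pow (hq : ‖q‖ < 1) :
    Summable fun E : Finset ℕ => ∏ i ∈ E, ‖q‖ ^ i :=
  summable_finsetProd_of_summable_nonneg (fun _ => by positivity)
    (summable_geometric_of_lt_one (norm_nonneg q) hq)

theorem summable_partWeight (hq : ‖q‖ < 1) (p : ℕ → Prop) [DecidablePred p] :
    Summable (partWeight q p) :=
  .of_norm_bounded (summable_prod_norm_pow hq) (norm_partWeight_le q p)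

theorem hasSum_partWeight (hq : ‖q‖ < 1) (p : ℕ → Prop) [DecidablePred p] :
    HasSum (partWeight q p) (∏' i : ℕ, (1 + if p i then -q ^ i else 0)) := by
  rw [tprod_one_add (summable_partWeight hq p)]
  exact (summable_partWeight hq p).hasSum

/-- The generating function of the sets of parts larger than `s`, signed by their cardinality. -/
theorem hasSum_partWeight_gt (hq : ‖q‖ < 1) (s : ℕ) :
    HasSum (partWeight q (s < ·)) (qPochInf (q ^ (s + 1)) q) := by
  convert hasSum_partWeight hq (s < ·) using 1
  have e : ∀ i : ℕ, 1 - q ^ (s + 1) * q ^ i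
      = 1 + if s < i + (s + 1) then -q ^ (i + (s + 1)) else 0 := fun i => by
    rw [if_pos (by omega)]; ring
  have hs := (qPochInf_multipliable (q ^ (s + 1)) q hq).congr e
  have h := hs.prod_mul_tprod_nat_mul' (f := fun i => 1 + if s < i then -q ^ i else 0)
  rw [Finset.prod_eq_one fun i hi => ?_, one_mul] at h
  · rw [← h, qPochInf]
    exact tprod_congr e
  · have := Finset.mem_range.1 hi
    rw [if_neg (by omega), add_zero]

/-- The generating function of the sets of parts in `[s, 2s)`, signed by their cardinality. -/
theorem hasSum_partWeight_Ico (hq : ‖q‖ < 1) (s : ℕ) :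
    HasSum (partWeight q fun i => s ≤ i ∧ i < 2 * s) (qPoch (q ^ s) q s) := by
  convert hasSum_partWeight hq (fun i => s ≤ i ∧ i < 2 * s) using 1
  rw [tprod_eq_prod (s := Finset.Ico s (2 * s)), Finset.prod_Ico_eq_prod_range, qPoch,
    show 2 * s - s = s by omega]
  · refine Finset.prod_congr rfl fun i hi => ?_
    have := Finset.mem_range.1 hi
    rw [if_pos (by omega)]
    ring
  · intro i hi
    rw [Finset.mem_Ico] at hi
    rw [if_neg hi, add_zero]

end PartSets

theorem HasSum.prod_mul {α β : Type*} {f : α → ℂ} {g : β → ℂ} {a b : ℂ} (hf : HasSum f a)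
    (hg : HasSum g b) : HasSum (fun x : α × β => f x.1 * g x.2) (a * b) :=
  hf.mul hg (summable_mul_of_summable_norm hf.summable.norm hg.summable.norm)

/-! ### Encoding the overpartition pairs by finite sets -/

section Encoding

namespace Overpartition

/-- The overpartition with distinct parts that has overlined parts `O` and non-overlined
parts `P`. -/
def ofFinsets (O P : Finset ℕ) (hO : ∀ x ∈ O, 0 < x) (hP : ∀ x ∈ P, 0 < x) : Overpartition where
  parts := O.val + P.val
  parts_pos x hx := (Multiset.mem_add.1 hx).elim (hO x) (hP x)
  overlined := O
  overlined_subset _ hx := Multiset.mem_add.2 (Or.inl hx)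

variable {O P : Finset ℕ} {hO : ∀ x ∈ O, 0 < x} {hP : ∀ x ∈ P, 0 < x}

theorem plain_ofFinsets : (ofFinsets O P hO hP).plain = P.val := by
  simp [plain, ofFinsets]

theorem sum_ofFinsets : (ofFinsets O P hO hP).parts.sum = O.sum id + P.sum id := by
  simp only [ofFinsets, Multiset.sum_add, Finset.sum_eq_multiset_sum, Multiset.map_id]

theorem card_ofFinsets : (ofFinsets O P hO hP).parts.card = O.card + P.card := by
  simp [ofFinsets]

theorem mem_parts_ofFinsets {x : ℕ} : x ∈ (ofFinsets O P hO hP).parts ↔ x ∈ O ∨ x ∈ P := by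
  simp [ofFinsets]

theorem overlined_val_le (l : Overpartition) : l.overlined.val ≤ l.parts :=
  (Multiset.le_iff_subset l.overlined.nodup).2 fun x hx => l.overlined_subset x hx

theorem overlined_add_plain (l : Overpartition) : l.overlined.val + l.plain = l.parts :=
  add_tsub_cancel_of_le l.overlined_val_le

theorem val_add_val_eq_parts {l : Overpartition} (hl : l.DistinctParts) (hO : O = l.overlined)
    (hP : ∀ x, x ∈ P ↔ x ∈ l.plain) : O.val + P.val = l.parts := by
  have : P.val = l.plain := (Multiset.Nodup.ext P.nodup hl).2 hP
  rw [hO, this, overlined_add_plain]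

end Overpartition

/-- Codes for the pairs counted by `A`: the smallest part `s`, then the sets of the remaining
overlined and of the non-overlined parts of the first component, then the sets of the overlined and
of the non-overlined parts of the second component. -/
abbrev PairCode : Type := ℕ+ × (Finset ℕ × Finset ℕ) × (Finset ℕ × Finset ℕ)

namespace PairCode

/-- The constraints on the parts in the definition of the pairs counted by `A`. -/
def Admissible (t : PairCode) : Prop :=
  (∀ i ∈ t.2.1.1, (t.1 : ℕ) < i) ∧ (∀ i ∈ t.2.1.2, (t.1 : ℕ) < i) ∧
    (∀ i ∈ t.2.2.1, (t.1 : ℕ) < i) ∧ ∀ i ∈ t.2.2.2, (t.1 : ℕ) ≤ i ∧ i < 2 * t.1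

/-- The contribution of a code to the generating function; it vanishes unless the code is
admissible. The sign is minus that of the parity of the number of parts, because the smallest part
contributes `q^s` instead of `-q^s`; this is the sign convention of `A'`. -/
noncomputable def weight (q : ℂ) (t : PairCode) : ℂ :=
  q ^ (t.1 : ℕ) *
    (partWeight q ((t.1 : ℕ) < ·) t.2.1.1 * partWeight q ((t.1 : ℕ) < ·) t.2.1.2 *
      (partWeight q ((t.1 : ℕ) < ·) t.2.2.1 *
        partWeight q (fun i => (t.1 : ℕ) ≤ i ∧ i < 2 * t.1) t.2.2.2))

/-- The overpartition pair with a given admissible code. -/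
def toPair (t : {t : PairCode // t.Admissible}) : Overpartition × Overpartition :=
  (.ofFinsets (insert (t.1.1 : ℕ) t.1.2.1.1) t.1.2.1.2
    (fun x hx => (Finset.mem_insert.1 hx).elim (fun h => h ▸ t.1.1.pos)
      fun h => (Nat.zero_le _).trans_lt (t.2.1 x h))
    (fun x hx => (Nat.zero_le _).trans_lt (t.2.2.1 x hx)),
  .ofFinsets t.1.2.2.1 t.1.2.2.2
    (fun x hx => (Nat.zero_le _).trans_lt (t.2.2.2.1 x hx))
    (fun x hx => t.1.1.pos.trans_le (t.2.2.2.2 x hx).1))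

theorem pairSize_toPair (t : {t : PairCode // t.Admissible}) :
    pairSize (toPair t) = t.1.1 + (t.1.2.1.1.sum id + t.1.2.1.2.sum id
      + (t.1.2.2.1.sum id + t.1.2.2.2.sum id)) := by
  have : (t.1.1 : ℕ) ∉ t.1.2.1.1 := fun h => (t.2.1 _ h).false
  simp only [pairSize, toPair, Overpartition.sum_ofFinsets, Finset.sum_insert this, id]
  ring

theorem numParts_toPair (t : {t : PairCode // t.Admissible}) :
    numParts (toPair t) = t.1.2.1.1.card + t.1.2.1.2.card
      + (t.1.2.2.1.card + t.1.2.2.2.card) + 1 := by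
  have : (t.1.1 : ℕ) ∉ t.1.2.1.1 := fun h => (t.2.1 _ h).false
  simp only [numParts, toPair, Overpartition.card_ofFinsets, Finset.card_insert_of_notMem this]
  ring

theorem weight_eq (q : ℂ) (t : {t : PairCode // t.Admissible}) :
    weight q t = (-1) ^ (numParts (toPair t) + 1) * q ^ pairSize (toPair t) := by
  obtain ⟨h1, h2, h3, h4⟩ := t.2
  rw [weight, partWeight_of_forall h1, partWeight_of_forall h2, partWeight_of_forall h3,
    partWeight_of_forall h4, pairSize_toPair, numParts_toPair]
  ring

theorem support_weight_subset (q : ℂ) : Function.support (weight q) ⊆ {t | t.Admissible} := by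
  intro t ht
  rw [Function.mem_support, weight, mul_ne_zero_iff, mul_ne_zero_iff, mul_ne_zero_iff,
    mul_ne_zero_iff] at ht
  exact ⟨forall_of_partWeight_ne_zero ht.2.1.1, forall_of_partWeight_ne_zero ht.2.1.2,
    forall_of_partWeight_ne_zero ht.2.2.1, forall_of_partWeight_ne_zero ht.2.2.2⟩

theorem toPair_injective : Function.Injective toPair := by
  rintro ⟨⟨s, ⟨E, F⟩, G, H⟩, h⟩ ⟨⟨s', ⟨E', F'⟩, G', H'⟩, h'⟩ e
  have e1 : insert (s : ℕ) E = insert (s' : ℕ) E' := congrArg (fun p => p.1.overlined) e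
  have e2 : F.val = F'.val := by
    simpa only [toPair, Overpartition.plain_ofFinsets] using congrArg (fun p => p.1.plain) e
  have e3 : G = G' := congrArg (fun p => p.2.overlined) e
  have e4 : H.val = H'.val := by
    simpa only [toPair, Overpartition.plain_ofFinsets] using congrArg (fun p => p.2.plain) e
  have hE : ∀ i ∈ E, (s : ℕ) < i := h.1
  have hE' : ∀ i ∈ E', (s' : ℕ) < i := h'.1
  have hs : s = s' := by
    have a : (s : ℕ) ∈ insert (s' : ℕ) E' := e1 ▸ Finset.mem_insert_self _ _
    have b : (s' : ℕ) ∈ insert (s : ℕ) E := e1 ▸ Finset.mem_insert_self _ _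
    rw [Finset.mem_insert] at a b
    refine PNat.coe_injective ?_
    rcases a with a | a
    · exact a
    rcases b with b | b
    · exact b.symm
    exact absurd (hE' _ a) (hE _ b).not_gt
  subst hs
  have hEE : E = E' := by
    rw [← Finset.erase_insert (fun m => (hE _ m).false : (s : ℕ) ∉ E), e1,
      Finset.erase_insert (fun m => (hE' _ m).false : (s : ℕ) ∉ E')]
  simp only [Finset.val_inj] at e2 e4
  subst hEE e2 e3 e4
  rfl

theorem isAPair_toPair (t : {t : PairCode // t.Admissible}) : IsAPair (toPair t) := by
  obtain ⟨⟨s, ⟨E, F⟩, G, H⟩, hE, hF, hG, hH⟩ := t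
  dsimp only at hE hF hG hH
  simp only [IsAPair, toPair, Overpartition.DistinctParts, Overpartition.plain_ofFinsets,
    Overpartition.mem_parts_ofFinsets]
  refine ⟨F.nodup, H.nodup, s, ⟨?_, ?_⟩, ⟨?_, ?_⟩, ?_, hF, hG, hH⟩
  · exact Or.inl (Or.inl (Finset.mem_insert_self _ _))
  · rintro x ((hx | hx) | (hx | hx))
    · exact (Finset.mem_insert.1 hx).elim (fun h => h.ge) fun h => (hE x h).le
    · exact (hF x hx).le
    · exact (hG x hx).le
    · exact (hH x hx).1
  · exact Or.inl (Finset.mem_insert_self _ _)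
  · rintro x (hx | hx)
    · exact (Finset.mem_insert.1 hx).elim (fun h => h.ge) fun h => (hE x h).le
    · exact (hF x hx).le
  · exact Finset.mem_insert_self _ _

theorem range_toPair : Set.range toPair = {p | IsAPair p} := by
  refine Set.Subset.antisymm ?_ ?_
  · rintro _ ⟨t, rfl⟩
    exact isAPair_toPair t
  · rintro ⟨l₁, l₂⟩ ⟨d1, d2, s, -, ⟨-, hmin⟩, hs, hF, hG, hH⟩
    dsimp only at d1 d2 hmin hs hF hG hH
    have hs0 : 0 < s := l₁.parts_pos s (l₁.overlined_subset s hs)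
    have hE : ∀ i ∈ l₁.overlined.erase s, s < i := fun i hi =>
      lt_of_le_of_ne (hmin (l₁.overlined_subset i (Finset.mem_of_mem_erase hi)))
        (Finset.ne_of_mem_erase hi).symm
    refine ⟨⟨(⟨s, hs0⟩, (l₁.overlined.erase s, l₁.plain.toFinset),
      (l₂.overlined, l₂.plain.toFinset)), hE, fun i hi => hF i (Multiset.mem_toFinset.1 hi), hG,
      fun i hi => hH i (Multiset.mem_toFinset.1 hi)⟩, ?_⟩
    have e := Finset.insert_erase hs
    exact Prod.ext
      (Overpartition.ext
        (Overpartition.val_add_val_eq_parts d1 e fun _ => Multiset.mem_toFinset) e)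
      (Overpartition.ext
        (Overpartition.val_add_val_eq_parts d2 rfl fun _ => Multiset.mem_toFinset) rfl)

/-- The weights are dominated by a product of five convergent series, one for each component of a
code, that does not involve the constraints linking the components. -/
theorem summable_weight {q : ℂ} (hq : ‖q‖ < 1) : Summable (weight q) := by
  have hg := summable_prod_norm_pow hq
  have g0 : ∀ E : Finset ℕ, 0 ≤ ∏ i ∈ E, ‖q‖ ^ i := fun E => by positivity
  have hs : Summable fun s : ℕ+ => ‖q‖ ^ (s : ℕ) :=
    (summable_geometric_of_lt_one (norm_nonneg q) hq).comp_injective PNat.coe_injective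
  have h2 := hg.mul_of_nonneg hg g0 g0
  have g2 : ∀ x : Finset ℕ × Finset ℕ, 0 ≤ (∏ i ∈ x.1, ‖q‖ ^ i) * ∏ i ∈ x.2, ‖q‖ ^ i :=
    fun x => mul_nonneg (g0 _) (g0 _)
  have h4 := h2.mul_of_nonneg h2 g2 g2
  refine .of_norm_bounded (hs.mul_of_nonneg h4 (fun _ => by positivity)
    fun x => mul_nonneg (g2 _) (g2 _)) fun t => ?_
  simp only [weight, norm_mul, norm_pow]
  have b1 := norm_partWeight_le q ((t.1 : ℕ) < ·)
  have b2 := norm_partWeight_le q fun i => (t.1 : ℕ) ≤ i ∧ i < 2 * t.1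
  gcongr <;> first | exact b1 _ | exact b2 _

/-- The codes with smallest part `s`: the overlined smallest part contributes `q^s`, each of the
three sets of parts `> s` a factor `(q^{s+1})_∞`, and the parts in `[s, 2s)` a factor `(q^s)_s`. -/
theorem hasSum_weight_fiber {q : ℂ} (hq : ‖q‖ < 1) (s : ℕ+) :
    HasSum (fun x => weight q (s, x))
      (q ^ (s : ℕ) * qPochInf (q ^ ((s : ℕ) + 1)) q ^ 3 * qPoch (q ^ (s : ℕ)) q s) := by
  have w := hasSum_partWeight_gt hq s
  have h := ((w.prod_mul w).prod_mul
    (w.prod_mul (hasSum_partWeight_Ico hq s))).mul_left (q ^ (s : ℕ))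
  have e : ∀ a b c : ℂ, a * b ^ 3 * c = a * (b * b * (b * c)) := fun a b c => by ring
  rw [e]
  exact h

end PairCode

/-! ### The generating function of `A'` -/

/-- Transport of the sum of the weights along the bijection `PairCode.toPair`. -/
theorem hasSum_APair {q : ℂ} (hq : ‖q‖ < 1) :
    HasSum (fun p : {p | IsAPair p} => (-1 : ℂ) ^ (numParts p + 1) * q ^ pairSize p)
      (∑' t, PairCode.weight q t) := by
  have h := (hasSum_subtype_iff_of_support_subset (PairCode.support_weight_subset q)).2
    (PairCode.summable_weight hq).hasSum
  rw [← PairCode.range_toPair]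
  refine (PairCode.toPair_injective.hasSum_range_iff
    (f := fun p => (-1 : ℂ) ^ (numParts p + 1) * q ^ pairSize p)).2 ?_
  exact h.congr_fun fun t => (PairCode.weight_eq q t).symm

theorem A'_zero : A' 0 = 0 := by
  have h : ∀ p, IsAPair p → pairSize p ≠ 0 := by
    rintro p ⟨-, -, s, -, ⟨hs, -⟩, -⟩ h0
    have h1 := p.1.parts_pos s hs
    have h2 := Multiset.single_le_sum (fun _ _ => Nat.zero_le _) s hs
    simp only [pairSize] at h0
    omega
  have h0 : {p | IsAPair p ∧ pairSize p = 0 ∧ Even (numParts p)} = ∅ :=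
    Set.eq_empty_of_forall_notMem fun p hp => h p hp.1 hp.2.1
  have h1 : {p | IsAPair p ∧ pairSize p = 0 ∧ Odd (numParts p)} = ∅ :=
    Set.eq_empty_of_forall_notMem fun p hp => h p hp.1 hp.2.1
  simp [A', A0, A1, h0, h1]

open Classical in
theorem A'_eq_sum (n : ℕ) :
    (A' n : ℂ) = ∑ p ∈ (finite_pairSize n).toFinset,
      if IsAPair p then (-1 : ℂ) ^ (numParts p + 1) else 0 := by
  have h0 : A0 n = ((finite_pairSize n).toFinset.filter
      fun p => IsAPair p ∧ Even (numParts p)).card := by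
    rw [A0, ← Set.ncard_coe_finset]
    congr 1
    ext p
    simp only [Set.mem_ofPred_eq, Finset.coe_filter, Set.Finite.mem_toFinset]
    tauto
  have h1 : A1 n = ((finite_pairSize n).toFinset.filter
      fun p => IsAPair p ∧ Odd (numParts p)).card := by
    rw [A1, ← Set.ncard_coe_finset]
    congr 1
    ext p
    simp only [Set.mem_ofPred_eq, Finset.coe_filter, Set.Finite.mem_toFinset]
    tauto
  rw [A', h0, h1]
  push_cast
  rw [Finset.natCast_card_filter, Finset.natCast_card_filter, ← Finset.sum_sub_distrib]
  refine Finset.sum_congr rfl fun p _ => ?_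
  by_cases hp : IsAPair p
  · rcases Nat.even_or_odd (numParts p) with he | ho
    · simp [hp, he, Nat.not_odd_iff_even.2 he, he.add_one.neg_one_pow]
    · simp [hp, ho, Nat.not_even_iff_odd.2 ho, ho.add_one.neg_one_pow]
  · simp [hp]

/-- The series of the `A' n`, obtained by grouping the pairs by their size. -/
theorem hasSum_A' {q : ℂ} (hq : ‖q‖ < 1) :
    HasSum (fun n : ℕ => (A' n : ℂ) * q ^ n) (∑' t, PairCode.weight q t) := by
  classical
  have h := ((hasSum_subtype_iff_indicator
    (f := fun p => (-1 : ℂ) ^ (numParts p + 1) * q ^ pairSize p)).1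
      (hasSum_APair hq)).tsum_fiberwise pairSize
  refine h.congr_fun fun n => ?_
  have e : pairSize ⁻¹' {n} = ((finite_pairSize n).toFinset : Set _) := by
    ext p; simp
  rw [e, Finset.tsum_subtype', A'_eq_sum, Finset.sum_mul]
  refine Finset.sum_congr rfl fun p hp => ?_
  have hp' : pairSize p = n := by simpa using hp
  rw [Set.indicator_apply, hp']
  by_cases h : IsAPair p <;> simp [h]

end Encoding

/-! ### The two identities -/

theorem theorem2 (q : ℂ) (hq : ‖q‖ < 1) :
    Summable (fun n : ℕ+ => (A' n : ℂ) * q ^ (n : ℕ)) ∧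
    Summable (fun n : ℕ+ =>
      q ^ (n : ℕ) * qPochInf (q ^ ((n : ℕ) + 1)) q ^ 3 * qPoch (q ^ (n : ℕ)) q n) ∧
    Summable (fun n : ℕ+ =>
      (-1 : ℂ) ^ ((n : ℕ) + 1) * ((n : ℕ) : ℂ) * q ^ ((n : ℕ) * ((n : ℕ) + 1) / 2)) ∧
    (∑' n : ℕ+, (A' n : ℂ) * q ^ (n : ℕ) =
      ∑' n : ℕ+, q ^ (n : ℕ) * qPochInf (q ^ ((n : ℕ) + 1)) q ^ 3 * qPoch (q ^ (n : ℕ)) q n) ∧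
    (∑' n : ℕ+, q ^ (n : ℕ) * qPochInf (q ^ ((n : ℕ) + 1)) q ^ 3 * qPoch (q ^ (n : ℕ)) q n =
      ∑' n : ℕ+,
        (-1 : ℂ) ^ ((n : ℕ) + 1) * ((n : ℕ) : ℂ) * q ^ ((n : ℕ) * ((n : ℕ) + 1) / 2)) := by
  -- Both sides of the first identity are the sum of the weights of all codes.
  have hA : HasSum (fun n : ℕ+ => (A' n : ℂ) * q ^ (n : ℕ)) (∑' t, PairCode.weight q t) := by
    refine (PNat.coe_injective.hasSum_iff (f := fun n : ℕ => (A' n : ℂ) * q ^ n) ?_).2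
      (hasSum_A' hq)
    intro n hn
    rcases Nat.eq_zero_or_pos n with rfl | h
    · simp [A'_zero]
    · exact absurd ⟨⟨n, h⟩, rfl⟩ hn
  have hB := (PairCode.summable_weight hq).hasSum.prod_fiberwise (PairCode.hasSum_weight_fiber hq)
  -- The shift `n ↦ n + 1` turns the remaining two series into `q W(q)` and `q H(q)` term by term.
  have eB : ∀ n : ℕ, q ^ (n + 1) * qPochInf (q ^ (n + 1 + 1)) q ^ 3
      * qPoch (q ^ (n + 1)) q (n + 1) = q * hyperTerm q q n := by
    intro n
    have h1 := qPochInf_eq hq (q ^ (n + 1))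
    have h2 := qPoch_add (q ^ (n + 1)) q 1 n
    rw [qPoch_one, pow_one, add_comm 1 n] at h2
    rw [← pow_succ] at h1 h2
    rw [h2, hyperTerm, h1, show q * q ^ (n + 1) = q ^ (n + 1 + 1) by ring,
      show q ^ 2 * q ^ n = q ^ (n + 1 + 1) by ring]
    ring
  have eC : ∀ n : ℕ, (-1 : ℂ) ^ (n + 1 + 1) * ((n + 1 : ℕ) : ℂ) * q ^ ((n + 1) * (n + 1 + 1) / 2)
      = q * partialThetaTerm q q n := by
    intro n
    have e : (n + 1) * (n + 1 + 1) / 2 = n * (n + 1) / 2 + n + 1 := by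
      have : (n + 1) * (n + 1 + 1) = n * (n + 1) + 2 * (n + 1) := by ring
      omega
    rw [e, partialThetaTerm]
    push_cast
    ring
  refine ⟨hA.summable, hB.summable, ?_, hA.tsum_eq.trans hB.tsum_eq.symm, ?_⟩
  · rw [summable_pnat_iff_summable_succ (f := fun n : ℕ =>
      (-1 : ℂ) ^ (n + 1) * (n : ℂ) * q ^ (n * (n + 1) / 2))]
    simp only [eC]
    exact (summable_partialThetaTerm hq hq.le).mul_left q
  · rw [tsum_pnat_eq_tsum_succ (f := fun n : ℕ =>
        q ^ n * qPochInf (q ^ (n + 1)) q ^ 3 * qPoch (q ^ n) q n),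
      tsum_pnat_eq_tsum_succ (f := fun n : ℕ =>
        (-1 : ℂ) ^ (n + 1) * (n : ℂ) * q ^ (n * (n + 1) / 2))]
    simp only [eB, eC, tsum_mul_left, tsum_hyperTerm_self hq]
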